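/- Let $V$ be a countable vocabulary of function symbols (including constant symbols) and predicate symbols of finite arities. A $V$-structure $\mathcal M$ has a non-empty universe $M$, interpretations $F^{\mathcal M}\colon M^n\to M$ of the function symbols, and interpretations $P^{\mathcal M}\colon M^n\to[0,1]$ of the predicate symbols. Continuous formulas are built from atomic formulas using all continuous functions $[0,1]^k\to[0,1]$ as connectives and the quantifiers $\inf$ and $\sup$; the truth value $0$ represents truth. $\mathrm{Th}(\mathcal M)$ is the set of all continuous $V$-sentences with value $0$ in $\mathcal M$, and $\mathcal M$ is a model of a set $T$ of sentences if each sentence of $T$ has value $0$ in $\mathcal M$. $\mathcal M$ is a metric structure if, for some binary predicate symbol $d\in V$ and some assignment of a modulus of uniform continuity to each symbol of $V$, $d^{\mathcal M}$ is a complete metric on $M$ and the interpretation of each symbol respects its modulus with respect to $d^{\mathcal M}$. A metric theory is a set $T$ of the form $\mathrm{Th}(\mathcal M)$ for a metric structure $\mathcal M$. Let $T$ be a metric theory. * $T$ is unstable if there are a continuous formula $\varphi(\vec x,\vec y)$, real numbers $0\le s<r\le 1$, a model $\mathcal M$ of $T$ and tuples $\vec a_h,\vec b_h$ in $\mathcal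 M$ ($h\in\mathbb N$) such that $\varphi^{\mathcal M}(\vec a_h,\vec b_k)\le s$ and $\varphi^{\mathcal M}(\vec a_k,\vec b_h)\ge r$ whenever $h<k$. * $T$ has SOP$_2$ if there are a continuous formula $\theta(\vec x,\vec z)$, a model $\mathcal M$ of $T$ and $|\vec z|$-tuples $\vec b_\mu$ in $\mathcal M$, for $\mu\in\{0,1\}^{<\mathbb N}$, such that, with $\vec x$ ranging over the $|\vec x|$-tuples in $\mathcal M$, $$\inf_{\vec x}\max_{k<n}\theta^{\mathcal M}(\vec x,\vec b_{\sigma|k})=0\quad\text{for all }\sigma\in\{0,1\}^{\mathbb N},\ n\in\mathbb N,$$ where $\sigma|k$ consists of the first $k$ entries of $\sigma$ (an empty maximum is $0$), and $$\inf_{\vec x}\max\bigl(\theta^{\mathcal M}(\vec x,\vec b_\mu),\theta^{\mathcal M}(\vec x,\vec b_\nu)\bigr)=1$$ for all $\mu,\nu\in\{0,1\}^{<\mathbb N}$ neither of which is an initial segment of the other. * $T$ has the independence property if there are a continuous formula $\varphi(\vec x,\vec y)$ and a model $\mathcal M$ of $T$ such that for each $m\in\mathbb N$ there are $|\vec x|$-tuples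 $\vec a_Z$ ($Z\subseteq\{0,\dots,m-1\}$) and $|\vec y|$-tuples $\vec b_n$ ($n<m$) in $\mathcal M$ with $\varphi^{\mathcal M}(\vec a_Z,\vec b_n)=0$ if $n\in Z$ and $\varphi^{\mathcal M}(\vec a_Z,\vec b_n)=1$ if $n\notin Z$. **Theorem.** A metric theory is unstable if and only if it has SOP$_2$ or the independence property. -/

import Mathlib

universe u v w

namespace ContinuousLogic

/-- A real-valued structure with vocabulary `V`: a non-empty universe, an operation for each function
symbol (constant symbols are the function symbols of arity `0`), and a `[0,1]`-valued map for each
predicate symbol. -/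
structure RStructure (V : FirstOrder.Language.{u, v}) where
  /-- The universe of the structure. -/
  carrier : Type w
  nonempty : Nonempty carrier
  /-- The interpretation of the function symbols. -/
  funMap : {n : ℕ} → V.Functions n → (Fin n → carrier) → carrier
  /-- The interpretation of the predicate symbols. -/
  predMap : {n : ℕ} → V.Relations n → (Fin n → carrier) → unitInterval

/-- The value of a term, with variables from `α`, under an assignment. -/
def termEval {V : FirstOrder.Language.{u, v}} (M : RStructure.{u, v, w} V) {α : Type} (a : α → M.carrier) :
    V.Term α → M.carrier
  | .var i => a i
  | .func F ts => M.funMap F (fun j => termEval M a (ts j))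

/-- Continuous formulas with vocabulary `V` and free variables among `v₀, …, v_{n-1}`: atomic
formulas, all continuous functions `[0,1]^k → [0,1]` as connectives, and the quantifiers `inf` and
`sup`, which bind the last variable `v_n`. -/
inductive CFormula (V : FirstOrder.Language.{u, v}) : ℕ → Type (max u v)
  | pred {n k : ℕ} (P : V.Relations k) (ts : Fin k → V.Term (Fin n)) : CFormula V n
  | conn {n k : ℕ} (f : C(Fin k → unitInterval, unitInterval)) (φs : Fin k → CFormula V n) :
      CFormula V n
  | inf {n : ℕ} (φ : CFormula V (n + 1)) : CFormula V n
  | sup {n : ℕ} (φ : CFormula V (n + 1)) : CFormula V n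

/-- The truth value of a continuous formula in a structure at a tuple. -/
noncomputable def CFormula.eval {V : FirstOrder.Language.{u, v}} (M : RStructure.{u, v, w} V) :
    {n : ℕ} → CFormula V n → (Fin n → M.carrier) → unitInterval
  | _, .pred P ts, a => M.predMap P (fun j => termEval M a (ts j))
  | _, .conn f φs, a => f (fun j => (φs j).eval M a)
  | _, .inf φ, a => ⨅ b : M.carrier, φ.eval M (Fin.snoc a b)
  | _, .sup φ, a => ⨆ b : M.carrier, φ.eval M (Fin.snoc a b)

/-- The truth value of `φ(x⃗, y⃗)` at `(a⃗, b⃗)`, where `x⃗` consists of the first `p` variables and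
`y⃗` of the last `q`. -/
noncomputable def CFormula.eval₂ {V : FirstOrder.Language.{u, v}} (M : RStructure.{u, v, w} V) {p q : ℕ}
    (φ : CFormula V (p + q)) (a : Fin p → M.carrier) (b : Fin q → M.carrier) : unitInterval :=
  φ.eval M (Fin.append a b)

/-- Continuous sentences. -/
abbrev CSentence (V : FirstOrder.Language.{u, v}) : Type (max u v) := CFormula V 0

/-- The theory of `M`: all sentences with truth value `0` (that is, true) in `M`. -/
def Th {V : FirstOrder.Language.{u, v}} (M : RStructure.{u, v, w} V) : Set (CSentence V) :=
  {φ | φ.eval M Fin.elim0 = 0}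

/-- `M` is a model of the set of sentences `T`. -/
def Models {V : FirstOrder.Language.{u, v}} (M : RStructure.{u, v, w} V) (T : Set (CSentence V)) : Prop :=
  ∀ φ ∈ T, φ.eval M Fin.elim0 = 0

/-- A modulus of uniform continuity. -/
abbrev Modulus : Type := Set.Ioc (0 : ℝ) 1 → Set.Ioc (0 : ℝ) 1

/-- A metric signature over `V`: a distinguished binary predicate symbol, and a modulus of uniform
continuity for each function and predicate symbol. -/
structure MetricSignature (V : FirstOrder.Language.{u, v}) where
  /-- The distance predicate. -/
  d : V.Relations 2
  /-- The moduli of the function symbols. -/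
  funModulus : {n : ℕ} → V.Functions n → Modulus
  /-- The moduli of the predicate symbols. -/
  predModulus : {n : ℕ} → V.Relations n → Modulus

/-- The interpretation of the distance predicate, as a real-valued function. -/
def MetricSignature.dist {V : FirstOrder.Language.{u, v}} (L : MetricSignature V) (M : RStructure.{u, v, w} V)
    (x y : M.carrier) : ℝ :=
  (M.predMap L.d ![x, y] : ℝ)

/-- `M` is an `L`-metric structure: the distance predicate is interpreted by a complete metric, and
the interpretation of each symbol respects its modulus of uniform continuity. -/
structure IsMetricStructure {V : FirstOrder.Language.{u, v}} (L : MetricSignature V)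
    (M : RStructure.{u, v, w} V) : Prop where
  complete_metric : ∃ m : MetricSpace M.carrier,
    (∀ x y : M.carrier, m.dist x y = L.dist M x y) ∧ @CompleteSpace M.carrier m.toUniformSpace
  funMap_modulus : ∀ {n : ℕ} (F : V.Functions n) (ε : Set.Ioc (0 : ℝ) 1) (x y : Fin n → M.carrier),
    (∀ i, L.dist M (x i) (y i) < L.funModulus F ε) → L.dist M (M.funMap F x) (M.funMap F y) ≤ ε
  predMap_modulus : ∀ {n : ℕ} (P : V.Relations n) (ε : Set.Ioc (0 : ℝ) 1)
    (x y : Fin n → M.carrier),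
    (∀ i, L.dist M (x i) (y i) < L.predModulus P ε) →
      |(M.predMap P x : ℝ) - (M.predMap P y : ℝ)| ≤ ε

/-- A metric theory: the theory of some metric structure. -/
def IsMetricTheory {V : FirstOrder.Language.{u, v}} (T : Set (CSentence V)) : Prop :=
  ∃ (L : MetricSignature V) (M : RStructure.{u, v, w} V), IsMetricStructure L M ∧ T = Th M

/-- `φ(x⃗, y⃗)` is unstable with bounds `(s, r)` in `T`. -/
def UnstableWithBounds {V : FirstOrder.Language.{u, v}} (T : Set (CSentence V)) {p q : ℕ}
    (φ : CFormula V (p + q)) (s r : unitInterval) : Prop :=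
  s < r ∧ ∃ M : RStructure.{u, v, w} V, Models M T ∧
    ∃ (a : ℕ → Fin p → M.carrier) (b : ℕ → Fin q → M.carrier),
      ∀ h k : ℕ, h < k → φ.eval₂ M (a h) (b k) ≤ s ∧ r ≤ φ.eval₂ M (a k) (b h)

/-- `φ(x⃗, y⃗)` is unstable in `T`. -/
def UnstableFormula {V : FirstOrder.Language.{u, v}} (T : Set (CSentence V)) {p q : ℕ}
    (φ : CFormula V (p + q)) : Prop :=
  ∃ s r : unitInterval, UnstableWithBounds.{u, v, w} T φ s r

/-- `T` is stable if every continuous formula `φ(x⃗, y⃗)` is stable in `T`. -/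
def IsStable {V : FirstOrder.Language.{u, v}} (T : Set (CSentence V)) : Prop :=
  ∀ (p q : ℕ) (φ : CFormula V (p + q)), ¬ UnstableFormula.{u, v, w} T φ

/-- `T` is unstable if it is not stable. -/
def IsUnstable {V : FirstOrder.Language.{u, v}} (T : Set (CSentence V)) : Prop :=
  ¬ IsStable.{u, v, w} T

/-- The restriction `σ|k` of an infinite `0`-`1`-sequence to its first `k` entries. -/
def initSeg (σ : ℕ → Bool) (k : ℕ) : List Bool :=
  List.ofFn (fun i : Fin k => σ i)

/-- `T` has SOP₂. The nodes of the full binary tree are the finite `0`-`1`-sequences, and two nodes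
are comparable if one is an initial segment of the other. An empty maximum is `0`. -/
def HasSOP₂ {V : FirstOrder.Language.{u, v}} (T : Set (CSentence V)) : Prop :=
  ∃ (p q : ℕ) (θ : CFormula V (p + q)) (M : RStructure.{u, v, w} V), Models M T ∧
    ∃ b : List Bool → Fin q → M.carrier,
      (∀ (σ : ℕ → Bool) (n : ℕ),
        (⨅ x : Fin p → M.carrier, ⨆ k : Fin n, θ.eval₂ M x (b (initSeg σ k))) = 0) ∧
      (∀ μ ν : List Bool, ¬ μ <+: ν → ¬ ν <+: μ →
        (⨅ x : Fin p → M.carrier, max (θ.eval₂ M x (b μ)) (θ.eval₂ M x (b ν))) = 1)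

/-- `T` has the independence property. -/
def HasIP {V : FirstOrder.Language.{u, v}} (T : Set (CSentence V)) : Prop :=
  ∃ (p q : ℕ) (φ : CFormula V (p + q)) (M : RStructure.{u, v, w} V), Models M T ∧
    ∀ m : ℕ, ∃ (a : Set (Fin m) → Fin p → M.carrier) (b : Fin m → Fin q → M.carrier),
      ∀ (n : Fin m) (Z : Set (Fin m)),
        (n ∈ Z → φ.eval₂ M (a Z) (b n) = 0) ∧ (n ∉ Z → φ.eval₂ M (a Z) (b n) = 1)

end ContinuousLogic

/-! Instability gives, after a threshold connective, a formula `φ` and sequences with `φ(a_h, b_k) =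
0` for `h ≤ k` and `1` for `k < h`. An ultrapower replaces the `b_k` by a family over the order `ℚ
×ₗ ℕ` for which the infimum over `x` of the maximum of a finite sign pattern (`φ` for a positive
sign, `1 - φ` for a negative one) depends only on the sequence of signs; call it `γ`
(`exists_indiscernible`). Iterated ultrafilter limits play the role of Ramsey's theorem. Negative
signs followed by positive ones have `γ = 0`.

Let `alternating m n` be `n` runs of `m` negative and `m` positive signs. If `γ` vanishes on all of
these, it vanishes on every sign pattern, and a threshold of `φ` has the independence property
(`IsPatternFamily.exists_independence`).

Otherwise take the least number of runs, necessarily `n + 2`, for which some `γ (alternating m (n +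
2)) = r` is positive. Assign nested or disjoint intervals to the nodes of the binary tree. Each node
asserts a fixed base of `n` runs, `m` negative signs at the left end of its interval and `m`
positive signs at the right end. Along a branch the intervals are nested and the signs merge into `n
+ 1` longer runs, of value `0`; two incomparable nodes have disjoint intervals and produce `n + 2`
runs, of value `r`. A threshold turns this into SOP₂ (`IsPatternFamily.exists_tree`).

Conversely, the independence property yields all finite cuts, hence an infinite order pattern in an
ultrapower; SOP₂ yields one along the branch of zeros. -/

open Filter Topology

namespace ContinuousLogic

/-! ### Ultrapowers and Łoś's theorem -/

section Ultrapower

variable {V : FirstOrder.Language.{u, v}} {I : Type}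

/-- The limit of a `[0,1]`-valued function along an ultrafilter. -/
noncomputable def ulim (W : Ultrafilter I) (f : I → unitInterval) : unitInterval :=
  (W.map f).lim

theorem tendsto_ulim (W : Ultrafilter I) (f : I → unitInterval) : Tendsto f W (𝓝 (ulim W f)) :=
  (W.map f).le_nhds_lim

/-- The power of a structure along an ultrafilter, without passing to a quotient: predicates are
evaluated by limits along the ultrafilter. -/
noncomputable def ultrapower (M : RStructure.{u, v, w} V) (W : Ultrafilter I) :
    RStructure.{u, v, w} V where
  carrier := I → M.carrier
  nonempty := have := M.nonempty; inferInstance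
  funMap F x := fun i => M.funMap F (fun j => x j i)
  predMap P x := ulim W (fun i => M.predMap P (fun j => x j i))

theorem termEval_ultrapower (M : RStructure.{u, v, w} V) (W : Ultrafilter I) {α : Type}
    (a : α → I → M.carrier) (t : V.Term α) (i : I) :
    (termEval (ultrapower M W) a t : I → M.carrier) i = termEval M (fun k => a k i) t := by
  induction t with
  | var k => rfl
  | func F ts ih => exact congrArg (M.funMap F) (funext ih)

/-- This is the quantifier step of Łoś's theorem. A single function `x` with `h x < c` bounds the
infima from above; a function choosing near-minimisers wherever they exist bounds them from below.
-/
theorem tendsto_iInf_of_tendsto {α X : Type*} [CompleteLinearOrder α] [TopologicalSpace α]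
    [OrderTopology α] [DenselyOrdered α] [Nonempty X] {F : Filter I} {g : I → X → α}
    {h : (I → X) → α} (H : ∀ x : I → X, Tendsto (fun i => g i (x i)) F (𝓝 (h x))) :
    Tendsto (fun i => ⨅ x, g i x) F (𝓝 (⨅ x, h x)) := by
  classical
  refine tendsto_order.2 ⟨fun c hc => ?_, fun c hc => ?_⟩
  · obtain ⟨d, hcd, hd⟩ := exists_between hc
    -- A Skolem function for `g i x < d`. Since `d < h x`, almost every `i` has no such witness; the
    -- default value is then immaterial.
    let x : I → X := fun i => if hx : ∃ x, g i x < d then hx.choose else Classical.arbitrary X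
    filter_upwards [(H x).eventually_const_lt (hd.trans_le (iInf_le h x))] with i hi
    refine hcd.trans_le (le_iInf fun y => not_lt.1 fun hy => ?_)
    have hex : ∃ x, g i x < d := ⟨y, hy⟩
    have : x i = hex.choose := dif_pos hex
    exact absurd (this ▸ hex.choose_spec) hi.not_gt
  · obtain ⟨x, hx⟩ := iInf_lt_iff.1 hc
    filter_upwards [(H x).eventually_lt_const hx] with i hi
    exact (iInf_le _ _).trans_lt hi

theorem tendsto_iSup_of_tendsto {α X : Type*} [CompleteLinearOrder α] [TopologicalSpace α]
    [OrderTopology α] [DenselyOrdered α] [Nonempty X] {F : Filter I} {g : I → X → α}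
    {h : (I → X) → α} (H : ∀ x : I → X, Tendsto (fun i => g i (x i)) F (𝓝 (h x))) :
    Tendsto (fun i => ⨆ x, g i x) F (𝓝 (⨆ x, h x)) :=
  tendsto_iInf_of_tendsto (α := αᵒᵈ) (g := g) (h := h) H

theorem snoc_apply_coordinate {X : Type*} {n : ℕ} (a : Fin n → I → X) (b : I → X) (i : I) :
    (fun k => (Fin.snoc a b : Fin (n + 1) → I → X) k i) =
      (Fin.snoc (fun k => a k i) (b i) : Fin (n + 1) → X) := by
  funext k
  induction k using Fin.lastCases <;> simp

/-- Łoś's theorem. -/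
theorem tendsto_eval_ultrapower (M : RStructure.{u, v, w} V) (W : Ultrafilter I) {n : ℕ}
    (φ : CFormula V n) (a : Fin n → I → M.carrier) :
    Tendsto (fun i => φ.eval M (fun k => a k i)) W (𝓝 (φ.eval (ultrapower M W) a)) := by
  induction φ with
  | pred P ts =>
    have e : (fun i => M.predMap P fun j => termEval M (fun k => a k i) (ts j)) = fun i =>
        M.predMap P fun j => (termEval (ultrapower M W) a (ts j) : I → M.carrier) i :=
      funext fun i => congrArg _ (funext fun j => (termEval_ultrapower M W a (ts j) i).symm)
    change Tendsto (fun i => M.predMap P fun j => termEval M (fun k => a k i) (ts j)) W _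
    rw [e]
    exact tendsto_ulim W _
  | conn f φs ih =>
    exact (f.continuous.tendsto _).comp (tendsto_pi_nhds.2 fun j => ih j a)
  | inf φ ih =>
    have := M.nonempty
    refine tendsto_iInf_of_tendsto (g := fun i b => φ.eval M (Fin.snoc (fun k => a k i) b))
      (h := fun b => φ.eval (ultrapower M W) (Fin.snoc a b)) fun b => ?_
    have hb := ih (Fin.snoc a b)
    simp only [snoc_apply_coordinate a b] at hb
    exact hb
  | sup φ ih =>
    have := M.nonempty
    refine tendsto_iSup_of_tendsto (g := fun i b => φ.eval M (Fin.snoc (fun k => a k i) b))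
      (h := fun b => φ.eval (ultrapower M W) (Fin.snoc a b)) fun b => ?_
    have hb := ih (Fin.snoc a b)
    simp only [snoc_apply_coordinate a b] at hb
    exact hb

theorem Models.ultrapower {M : RStructure.{u, v, w} V} {T : Set (CSentence V)} (hM : Models M T)
    (W : Ultrafilter I) : Models (ultrapower M W) T := fun φ hφ => by
  have h := tendsto_eval_ultrapower M W φ Fin.elim0
  have e : ∀ i, (fun k => (Fin.elim0 k : I → M.carrier) i) = (Fin.elim0 : Fin 0 → M.carrier) :=
    fun i => Subsingleton.elim _ _
  simp only [e, hM φ hφ] at h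
  exact tendsto_nhds_unique h tendsto_const_nhds

theorem tendsto_eval₂_ultrapower (M : RStructure.{u, v, w} V) (W : Ultrafilter I) {p q : ℕ}
    (φ : CFormula V (p + q)) (a : Fin p → I → M.carrier) (b : Fin q → I → M.carrier) :
    Tendsto (fun i => φ.eval₂ M (fun k => a k i) (fun k => b k i)) W
      (𝓝 (φ.eval₂ (ContinuousLogic.ultrapower M W) a b)) := by
  have e : ∀ i, (Fin.append (fun k => a k i) (fun k => b k i) : Fin (p + q) → M.carrier) =
      fun k => (Fin.append a b : Fin (p + q) → I → M.carrier) k i := by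
    intro i
    funext k
    induction k using Fin.addCases <;> simp
  simp only [CFormula.eval₂, e]
  exact tendsto_eval_ultrapower M W φ _

end Ultrapower

/-! ### Iterated products of an ultrafilter -/

section IteratedUltrafilter

/-- The iterated product of an ultrafilter, on lists. -/
noncomputable def listUltrafilter (U : Ultrafilter ℕ) : ℕ → Ultrafilter (List ℕ)
  | 0 => pure []
  | n + 1 => U.bind fun k => (listUltrafilter U n).map (List.cons k)

variable {J : Type} [LinearOrder J]

/-- The iterated product of an ultrafilter in the coordinates belonging to a list. -/
noncomputable def coordUltrafilter (U : Ultrafilter ℕ) : List J → Ultrafilter (J → ℕ)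
  | [] => pure 0
  | j :: l => U.bind fun k => (coordUltrafilter U l).map fun f => Function.update f j k

/-- Integrating over a coordinate on which `A` does not depend changes nothing, so the coordinates
outside `l₁` can be dropped one at a time. -/
theorem coordUltrafilter_sublist (U : Ultrafilter ℕ) {l₁ l₂ : List J} (h : l₁.Sublist l₂)
    (hl₂ : l₂.Nodup) (A : Set (J → ℕ))
    (hA : ∀ f g : J → ℕ, (∀ j ∈ l₁, f j = g j) → (f ∈ A ↔ g ∈ A)) :
    A ∈ coordUltrafilter U l₂ ↔ A ∈ coordUltrafilter U l₁ := by
  induction h generalizing A with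
  | slnil => rfl
  | @cons l₁ l₂ q h ih =>
    have hq : q ∉ l₁ := fun hq => (List.nodup_cons.1 hl₂).1 (h.subset hq)
    rw [← ih (List.nodup_cons.1 hl₂).2 A hA]
    have : ∀ k, (fun f : J → ℕ => Function.update f q k) ⁻¹' A = A := fun k => Set.ext fun f =>
      hA _ _ fun j hj => Function.update_of_ne (ne_of_mem_of_not_mem hj hq) _ _
    change (∀ᶠ k in (U : Filter ℕ), (fun f : J → ℕ => Function.update f q k) ⁻¹' A ∈
      coordUltrafilter U l₂) ↔ _
    simp only [this, eventually_const]
  | @cons_cons l₁ l₂ q h ih =>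
    refine eventually_congr (f := (U : Filter ℕ)) (Eventually.of_forall fun k => ?_)
    refine ih (List.nodup_cons.1 hl₂).2 _ fun f g hfg => hA _ _ fun j hj => ?_
    by_cases hjq : j = q
    · subst hjq; simp
    · beta_reduce
      rw [Function.update_of_ne hjq, Function.update_of_ne hjq]
      exact hfg j ((List.mem_cons.1 hj).resolve_left hjq)

theorem map_coordUltrafilter (U : Ultrafilter ℕ) {l : List J} (hl : l.Nodup) :
    (coordUltrafilter U l).map (fun f => l.map f) = listUltrafilter U l.length := by
  ext A
  induction l generalizing A with
  | nil => rfl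
  | cons q l ih =>
    refine eventually_congr (f := (U : Filter ℕ)) (Eventually.of_forall fun k => ?_)
    have hq := List.nodup_cons.1 hl
    refine Iff.trans ?_ (ih hq.2 (List.cons k ⁻¹' A))
    have : ∀ f : J → ℕ, (q :: l).map (Function.update f q k) = k :: l.map f := fun f => by
      rw [List.map_cons, Function.update_self]
      exact congrArg _ (List.map_congr_left fun j hj =>
        Function.update_of_ne (ne_of_mem_of_not_mem hj hq.1) _ _)
    change {f | (q :: l).map (Function.update f q k) ∈ A} ∈ coordUltrafilter U l ↔
      {f | k :: l.map f ∈ A} ∈ coordUltrafilter U l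
    simp only [this]

/-- An ultrafilter on `J → ℕ` whose projection to any increasing list of coordinates is an iterated
product of `U`. -/
noncomputable def orderUltrafilter (J : Type) [LinearOrder J] (U : Ultrafilter ℕ) :
    Ultrafilter (J → ℕ) :=
  (Ultrafilter.of (atTop : Filter (Finset J))).bind fun s => coordUltrafilter U s.sort

/-- Almost every finite `s` contains `l`, and then `l` is a sublist of the sorted `s`, so the other
coordinates drop out. The right side sees only the length of `l`: this is the source of
indiscernibility. -/
theorem map_orderUltrafilter (U : Ultrafilter ℕ) {l : List J} (hl : l.SortedLT) :
    (orderUltrafilter J U).map (fun f => l.map f) = listUltrafilter U l.length := by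
  rw [← map_coordUltrafilter U hl.nodup]
  ext A
  have hs : ∀ᶠ s in (Ultrafilter.of (atTop : Filter (Finset J)) : Filter (Finset J)),
      ((fun f : J → ℕ => l.map f) ⁻¹' A ∈ coordUltrafilter U s.sort ↔
        (fun f : J → ℕ => l.map f) ⁻¹' A ∈ coordUltrafilter U l) := by
    filter_upwards [Ultrafilter.of_le _ (eventually_ge_atTop l.toFinset)] with s hs
    have hsub : l.Sublist s.sort := List.sublist_of_subperm_of_sortedLE
      (List.subperm_of_subset hl.nodup fun j hj => (Finset.mem_sort _).2 (hs (by simpa using hj)))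
      hl.sortedLE s.sortedLT_sort.sortedLE
    refine coordUltrafilter_sublist U hsub s.sortedLT_sort.nodup _ fun f g hfg => ?_
    change l.map f ∈ A ↔ l.map g ∈ A
    rw [List.map_congr_left hfg]
  exact (eventually_congr hs).trans eventually_const

theorem eventually_listUltrafilter {U : Ultrafilter ℕ} (hU : (U : Filter ℕ) ≤ atTop) (n : ℕ) :
    ∀ᶠ v in (listUltrafilter U n : Filter (List ℕ)), v.length = n ∧ v.Pairwise (· < ·) := by
  -- The lower bound `m` on all entries makes the induction work: the tail is required to lie above
  -- the head.
  suffices h : ∀ m : ℕ, ∀ᶠ v in (listUltrafilter U n : Filter (List ℕ)),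
      v.length = n ∧ v.Pairwise (· < ·) ∧ ∀ k ∈ v, m < k from
    (h 0).mono fun v hv => ⟨hv.1, hv.2.1⟩
  induction n with
  | zero =>
    intro m
    exact (Ultrafilter.mem_pure (a := ([] : List ℕ))).2 (by simp)
  | succ n ih =>
    intro m
    change ∀ᶠ k in (U : Filter ℕ), ∀ᶠ v in (listUltrafilter U n : Filter (List ℕ)), _
    filter_upwards [hU (eventually_gt_atTop m)] with k hk
    filter_upwards [ih k] with v hv
    refine ⟨by simp [hv.1], List.pairwise_cons.2 ⟨hv.2.2, hv.2.1⟩, ?_⟩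
    simp only [List.mem_cons, forall_eq_or_imp]
    exact ⟨hk, fun j hj => lt_trans hk (hv.2.2 j hj)⟩

end IteratedUltrafilter

/-! ### Threshold connectives and renaming of variables -/

section Formulas

variable {V : FirstOrder.Language.{u, v}}

/-- The piecewise linear connective with value `0` up to `s` and value `1` from `r` on. -/
noncomputable def threshold (s r : unitInterval) : C(unitInterval, unitInterval) where
  toFun t := Set.projIcc (0 : ℝ) 1 zero_le_one (((t : ℝ) - s) / (r - s))
  continuous_toFun := continuous_projIcc.comp (by fun_prop)

theorem threshold_eq_zero {s r t : unitInterval} (hsr : s < r) (ht : t ≤ s) :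
    threshold s r t = 0 :=
  Set.projIcc_of_le_left zero_le_one
    (div_nonpos_of_nonpos_of_nonneg (sub_nonpos.2 ht) (sub_nonneg.2 (Subtype.coe_le_coe.2 hsr.le)))

theorem threshold_eq_one {s r t : unitInterval} (hsr : s < r) (ht : r ≤ t) :
    threshold s r t = 1 :=
  Set.projIcc_of_right_le zero_le_one <| by
    rw [one_le_div (sub_pos.2 (Subtype.coe_lt_coe.2 hsr))]
    exact sub_le_sub_right (Subtype.coe_le_coe.2 ht) _

/-- The application of a unary connective. -/
def CFormula.comp (g : C(unitInterval, unitInterval)) {n : ℕ} (φ : CFormula V n) : CFormula V n :=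
  .conn (k := 1) (g.comp ⟨fun t => t 0, by fun_prop⟩) fun _ => φ

theorem CFormula.eval₂_comp (M : RStructure.{u, v, w} V) (g : C(unitInterval, unitInterval))
    {p q : ℕ} (φ : CFormula V (p + q)) (a : Fin p → M.carrier) (b : Fin q → M.carrier) :
    (φ.comp g).eval₂ M a b = g (φ.eval₂ M a b) :=
  rfl

/-- Renaming of free variables. -/
def CFormula.rename {n : ℕ} : CFormula V n → ∀ {m : ℕ}, (Fin n → Fin m) → CFormula V m
  | .pred P ts, _, f => .pred P fun j => (ts j).relabel f
  | .conn g φs, _, f => .conn g fun j => (φs j).rename f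
  | .inf φ, m, f => .inf (φ.rename (Fin.snoc (fun k => (f k).castSucc) (Fin.last m)))
  | .sup φ, m, f => .sup (φ.rename (Fin.snoc (fun k => (f k).castSucc) (Fin.last m)))

theorem termEval_relabel (M : RStructure.{u, v, w} V) {α β : Type} (f : α → β)
    (a : β → M.carrier) (t : V.Term α) :
    termEval M a (t.relabel f) = termEval M (fun k => a (f k)) t := by
  induction t with
  | var k => rfl
  | func F ts ih => exact congrArg (M.funMap F) (funext ih)

theorem snoc_comp_snoc_castSucc {X : Type*} {n m : ℕ} (f : Fin n → Fin m) (a : Fin m → X) (b : X) :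
    (fun k => (Fin.snoc a b : Fin (m + 1) → X)
      ((Fin.snoc (fun k => (f k).castSucc) (Fin.last m) : Fin (n + 1) → Fin (m + 1)) k)) =
      (Fin.snoc (fun k => a (f k)) b : Fin (n + 1) → X) := by
  funext k
  induction k using Fin.lastCases <;> simp

theorem CFormula.eval_rename (M : RStructure.{u, v, w} V) {n : ℕ} (φ : CFormula V n) {m : ℕ}
    (f : Fin n → Fin m) (a : Fin m → M.carrier) :
    (φ.rename f).eval M a = φ.eval M fun k => a (f k) := by
  induction φ generalizing m with
  | pred P ts => simp only [rename, eval, termEval_relabel]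
  | conn g φs ih => simp only [rename, eval, ih]
  | inf φ ih => simp only [rename, eval, ih, snoc_comp_snoc_castSucc]
  | sup φ ih => simp only [rename, eval, ih, snoc_comp_snoc_castSucc]

end Formulas

/-! ### Sign patterns and indiscernible families -/

section Patterns

variable {V : FirstOrder.Language.{u, v}} {p q : ℕ}

/-- A truth value or its negation. -/
def lit : Bool → unitInterval → unitInterval
  | true, t => t
  | false, t => unitInterval.symm t

theorem continuous_lit (e : Bool) : Continuous (lit e) := by
  cases e
  · exact unitInterval.continuous_symm
  · exact continuous_id

/-- The maximum of `φ(x, y)` over the positive entries `y` and of `1 - φ(x, y)` over the negative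
entries `y` of a list. -/
noncomputable def patVal (M : RStructure.{u, v, w} V) (φ : CFormula V (p + q)) (x : Fin p → M.carrier) :
    List (Bool × (Fin q → M.carrier)) → unitInterval
  | [] => 0
  | e :: l => max (lit e.1 (φ.eval₂ M x e.2)) (patVal M φ x l)

theorem patVal_le_iff {M : RStructure.{u, v, w} V} {φ : CFormula V (p + q)}
    {x : Fin p → M.carrier} {l : List (Bool × (Fin q → M.carrier))} {t : unitInterval} :
    patVal M φ x l ≤ t ↔ ∀ e ∈ l, lit e.1 (φ.eval₂ M x e.2) ≤ t := by
  induction l with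
  | nil => simp [patVal]
  | cons e l ih => simp [patVal, ih]

theorem patVal_mono {M : RStructure.{u, v, w} V} {φ : CFormula V (p + q)}
    {x : Fin p → M.carrier} {l₁ l₂ : List (Bool × (Fin q → M.carrier))} (h : l₁ ⊆ l₂) :
    patVal M φ x l₁ ≤ patVal M φ x l₂ :=
  patVal_le_iff.2 fun e he => patVal_le_iff.1 le_rfl e (h he)

/-- The infimum of `patVal` over all `x`. -/
noncomputable def patInf (M : RStructure.{u, v, w} V) (φ : CFormula V (p + q))
    (l : List (Bool × (Fin q → M.carrier))) : unitInterval :=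
  ⨅ x, patVal M φ x l

theorem patInf_mono {M : RStructure.{u, v, w} V} {φ : CFormula V (p + q)}
    {l₁ l₂ : List (Bool × (Fin q → M.carrier))} (h : l₁ ⊆ l₂) : patInf M φ l₁ ≤ patInf M φ l₂ :=
  iInf_mono fun _ => patVal_mono h

theorem tendsto_patVal_ultrapower {I : Type} (M : RStructure.{u, v, w} V) (W : Ultrafilter I)
    (φ : CFormula V (p + q)) (x : Fin p → I → M.carrier)
    (l : List (Bool × (Fin q → I → M.carrier))) :
    Tendsto (fun i => patVal M φ (fun k => x k i) (l.map fun e => (e.1, fun k => e.2 k i))) W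
      (𝓝 (patVal (ultrapower M W) φ x l)) := by
  induction l with
  | nil => exact tendsto_const_nhds
  | cons e l ih =>
    exact (((continuous_lit e.1).tendsto _).comp (tendsto_eval₂_ultrapower M W φ x e.2)).max ih

theorem tendsto_patInf_ultrapower {I : Type} (M : RStructure.{u, v, w} V) (W : Ultrafilter I)
    (φ : CFormula V (p + q)) (l : List (Bool × (Fin q → I → M.carrier))) :
    Tendsto (fun i => patInf M φ (l.map fun e => (e.1, fun k => e.2 k i))) W
      (𝓝 (patInf (ultrapower M W) φ l)) := by
  have := M.nonempty
  -- A `p`-tuple in the ultrapower is the same as an `I`-indexed family of `p`-tuples in `M`, the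
  -- form in which limits commute with infima.
  have e : patInf (ultrapower M W) φ l =
      ⨅ x : I → Fin p → M.carrier, patVal (ultrapower M W) φ (fun k i => x i k) l :=
    ((Equiv.piComm fun (_ : I) (_ : Fin p) => M.carrier).iInf_comp
      (g := fun x => patVal (ultrapower M W) φ x l)).symm
  rw [e]
  exact tendsto_iInf_of_tendsto (X := Fin p → M.carrier) fun x =>
    tendsto_patVal_ultrapower M W φ (fun k i => x i k) l

/-- An order pattern yields, in an ultrapower, a family indexed by any given linear order whose
patterns depend only on their order type. -/
theorem exists_indiscernible {M : RStructure.{u, v, w} V} {T : Set (CSentence V)}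
    (hM : Models M T) (φ : CFormula V (p + q)) (a : ℕ → Fin p → M.carrier)
    (b : ℕ → Fin q → M.carrier) (h₀ : ∀ h k, h ≤ k → φ.eval₂ M (a h) (b k) = 0)
    (h₁ : ∀ h k, k < h → φ.eval₂ M (a h) (b k) = 1) (J : Type) [LinearOrder J] :
    ∃ N : RStructure.{u, v, w} V, Models N T ∧
      ∃ (c : J → Fin q → N.carrier) (γ : List Bool → unitInterval),
        (∀ l : List (Bool × J), (l.map Prod.snd).SortedLT →
          patInf N φ (l.map fun e => (e.1, c e.2)) = γ (l.map Prod.fst)) ∧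
        ∀ m n, γ (List.replicate m false ++ List.replicate n true) = 0 := by
  let U := hyperfilter ℕ
  let W := orderUltrafilter J U
  let F : List Bool → List ℕ → unitInterval := fun η v =>
    patInf M φ ((η.zip v).map fun e => (e.1, b e.2))
  refine ⟨ultrapower M W, hM.ultrapower W, fun j k f => b (f j) k,
    fun η => ulim (listUltrafilter U η.length) (F η), fun l hl => ?_, fun m n => ?_⟩
  · have hF := tendsto_ulim (listUltrafilter U (l.map Prod.fst).length) (F (l.map Prod.fst))
    have hlen : (l.map Prod.fst).length = (l.map Prod.snd).length := by simp
    -- Naming the limit lets the following rewrite affect only the filter.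
    generalize htt : ulim (listUltrafilter U (l.map Prod.fst).length) (F (l.map Prod.fst)) = t at hF
    rw [hlen, ← map_orderUltrafilter U hl, Ultrafilter.coe_map, tendsto_map'_iff] at hF
    have e : ∀ f : J → ℕ, F (l.map Prod.fst) ((l.map Prod.snd).map f) =
        patInf M φ ((l.map fun e => (e.1, fun k (f : J → ℕ) => b (f e.2) k)).map
          fun e => (e.1, fun k => e.2 k f)) := by
      intro f
      refine congrArg (patInf M φ) ?_
      clear hl hF hlen htt
      induction l with
      | nil => rfl
      | cons e l ih => simpa using ih
    have hF' := tendsto_patInf_ultrapower M W φ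
      (l.map fun e => (e.1, fun k (f : J → ℕ) => b (f e.2) k))
    exact (tendsto_nhds_unique hF' (hF.congr e)).trans htt.symm
  · refine tendsto_nhds_unique (tendsto_ulim _ _) (tendsto_const_nhds.congr' ?_)
    filter_upwards [eventually_listUltrafilter (U := U) Nat.hyperfilter_le_atTop _] with v hv
    symm
    obtain ⟨hlen, hv⟩ := hv
    rw [← List.take_append_drop m v] at hv ⊢
    rw [List.pairwise_append] at hv
    have hlen' : (v.take m).length = m := by simp at hlen ⊢; omega
    -- The witness has index one more than the largest of the first `m` entries (`0` if there are
    -- none): above all negative indices and, as `v` increases, at most every positive one.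
    refine le_antisymm ((iInf_le _ (a ((v.take m).toFinset.sup Nat.succ))).trans
      (patVal_le_iff.2 fun e he => ?_)) bot_le
    rw [List.zip_append (by simpa using hlen'.symm), List.map_append, List.mem_append] at he
    rcases he with he | he
    · obtain ⟨⟨i, k⟩, hik, rfl⟩ := List.mem_map.1 he
      obtain ⟨hi, hk⟩ := List.of_mem_zip hik
      obtain rfl := List.eq_of_mem_replicate hi
      have : k < (v.take m).toFinset.sup Nat.succ :=
        Finset.le_sup (f := Nat.succ) (List.mem_toFinset.2 hk)
      simp [lit, h₁ _ _ this]
    · obtain ⟨⟨i, k⟩, hik, rfl⟩ := List.mem_map.1 he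
      obtain ⟨hi, hk⟩ := List.of_mem_zip hik
      obtain rfl := List.eq_of_mem_replicate hi
      have : (v.take m).toFinset.sup Nat.succ ≤ k :=
        Finset.sup_le fun j hj => hv.2.2 j (List.mem_toFinset.1 hj) k hk
      simp [lit, h₀ _ _ this]

end Patterns

/-! ### Patterns as instances of one formula -/

section ParametrizedPatterns

variable {V : FirstOrder.Language.{u, v}} {p q : ℕ}

theorem patVal_ofFn (M : RStructure.{u, v, w} V) (φ : CFormula V (p + q)) (x : Fin p → M.carrier)
    {n : ℕ} (η : Fin n → Bool) (y : Fin n → Fin q → M.carrier) :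
    patVal M φ x (List.ofFn fun i => (η i, y i)) =
      Finset.univ.sup fun i => lit (η i) (φ.eval₂ M x (y i)) :=
  eq_of_forall_ge_iff fun t => by
    simp [patVal_le_iff]

/-- The patterns with given signs are the instances of a single formula. -/
theorem exists_formula_patVal (φ : CFormula V (p + q)) (η : List Bool)
    (g : C(unitInterval, unitInterval)) :
    ∃ (n : ℕ) (θ : CFormula V (p + n)), ∀ (M : RStructure.{u, v, w} V)
      (l : List (Bool × (Fin q → M.carrier))), l.map Prod.fst = η →
        ∃ z : Fin n → M.carrier, ∀ x, θ.eval₂ M x z = g (patVal M φ x l) := by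
  let f : C(Fin η.length → unitInterval, unitInterval) :=
    ⟨fun t => g (Finset.univ.sup fun i => lit (η.get i) (t i)),
      g.continuous.comp (Continuous.finset_sup_apply fun i _ =>
        (continuous_lit _).comp (continuous_apply i))⟩
  refine ⟨η.length * q, .conn f fun i => φ.rename (Fin.append (Fin.castAdd _)
    fun j => Fin.natAdd p (finProdFinEquiv (i, j))), fun M l hl => ?_⟩
  subst hl
  refine ⟨fun t => (l.get ((finProdFinEquiv.symm t).1.cast (by simp))).2 (finProdFinEquiv.symm t).2,
    fun x => ?_⟩
  have e : l = List.ofFn fun i : Fin (l.map Prod.fst).length =>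
      ((l.map Prod.fst).get i, (l.get (i.cast (by simp))).2) := by
    refine List.ext_get (by simp) fun i h₁ h₂ => ?_
    simp
  conv_rhs => rw [e, patVal_ofFn]
  change g (Finset.univ.sup _) = _
  refine congrArg g (Finset.sup_congr rfl fun i _ => congrArg _ ?_)
  refine (CFormula.eval_rename M φ _ _).trans ?_
  refine congrArg (φ.eval M) (funext fun k => ?_)
  induction k using Fin.addCases with
  | left k => simp
  | right k =>
    simp only [Fin.append_right, Equiv.symm_apply_apply]

end ParametrizedPatterns

/-! ### Intervals on the binary tree -/

section Intervals

/-- The left end of the interval assigned to a node of the full binary tree. -/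
def lowerEnd : List Bool → ℚ
  | [] => 0
  | e :: μ => ((if e then 3 else 1) + lowerEnd μ) / 5

/-- The right end of the interval assigned to a node of the full binary tree. -/
def upperEnd : List Bool → ℚ
  | [] => 1
  | e :: μ => ((if e then 3 else 1) + upperEnd μ) / 5

/-- The maps `t ↦ (1 + t) / 5` and `t ↦ (3 + t) / 5` send `[0, 1]` to `[1/5, 2/5]` and `[3/5, 4/5]`.
These are disjoint and interior to `[0, 1]`, so child intervals are strictly nested and incomparable
nodes are separated by a gap. -/
theorem lowerEnd_upperEnd_bounds (μ : List Bool) :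
    0 ≤ lowerEnd μ ∧ lowerEnd μ < upperEnd μ ∧ upperEnd μ ≤ 1 := by
  induction μ with
  | nil => simp [lowerEnd, upperEnd]
  | cons e μ ih =>
    simp only [lowerEnd, upperEnd]
    refine ⟨?_, ?_, ?_⟩ <;> split <;> linarith

theorem lowerEnd_lt_append (μ : List Bool) (e : Bool) : lowerEnd μ < lowerEnd (μ ++ [e]) := by
  induction μ with
  | nil => cases e <;> norm_num [lowerEnd]
  | cons e' μ ih => simp only [lowerEnd, List.cons_append]; linarith

theorem upperEnd_append_lt (μ : List Bool) (e : Bool) : upperEnd (μ ++ [e]) < upperEnd μ := by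
  induction μ with
  | nil => cases e <;> norm_num [upperEnd]
  | cons e' μ ih => simp only [upperEnd, List.cons_append]; linarith

theorem upperEnd_lt_lowerEnd_or {μ ν : List Bool} (h₁ : ¬ μ <+: ν) (h₂ : ¬ ν <+: μ) :
    upperEnd μ < lowerEnd ν ∨ upperEnd ν < lowerEnd μ := by
  induction μ generalizing ν with
  | nil => exact absurd List.nil_prefix h₁
  | cons e μ ih =>
    cases ν with
    | nil => exact absurd List.nil_prefix h₂
    | cons e' ν =>
      have hμ := lowerEnd_upperEnd_bounds μ
      have hν := lowerEnd_upperEnd_bounds ν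
      by_cases he : e = e'
      · subst he
        rw [List.cons_prefix_cons] at h₁ h₂
        rcases ih (fun h => h₁ ⟨rfl, h⟩) (fun h => h₂ ⟨rfl, h⟩) with h | h
        · left; simp only [lowerEnd, upperEnd]; linarith
        · right; simp only [lowerEnd, upperEnd]; linarith
      · cases e <;> cases e' <;> simp_all only [lowerEnd, upperEnd, not_true_eq_false, if_true]
        · left; norm_num; linarith
        · right; norm_num; linarith

theorem initSeg_succ (σ : ℕ → Bool) (k : ℕ) : initSeg σ (k + 1) = initSeg σ k ++ [σ k] := by
  rw [initSeg, List.ofFn_succ_last]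
  rfl

theorem strictMono_lowerEnd_initSeg (σ : ℕ → Bool) : StrictMono fun k => lowerEnd (initSeg σ k) :=
  strictMono_nat_of_lt_succ fun k => by
    simp only [initSeg_succ]
    exact lowerEnd_lt_append _ _

theorem strictAnti_upperEnd_initSeg (σ : ℕ → Bool) : StrictAnti fun k => upperEnd (initSeg σ k) :=
  strictAnti_nat_of_succ_lt fun k => by
    simp only [initSeg_succ]
    exact upperEnd_append_lt _ _

end Intervals

/-! ### Blocks of signs over rationals -/

section Blocks

/-- A list of signs placed on the fibre over a rational. -/
def fiberList (b : List Bool × ℚ) : List (Bool × ℚ ×ₗ ℕ) :=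
  b.1.zip ((List.range b.1.length).map fun i => toLex (b.2, i))

theorem map_fst_fiberList (b : List Bool × ℚ) : (fiberList b).map Prod.fst = b.1 :=
  List.map_fst_zip (by simp)

theorem map_snd_fiberList (b : List Bool × ℚ) :
    (fiberList b).map Prod.snd = (List.range b.1.length).map fun i => toLex (b.2, i) :=
  List.map_snd_zip (by simp)

theorem map_fst_flatMap_fiberList (B : List (List Bool × ℚ)) :
    (B.flatMap fiberList).map Prod.fst = B.flatMap Prod.fst := by
  simp only [List.map_flatMap, map_fst_fiberList]

/-- In the lexicographic order each rational carries a copy of `ℕ`, which has room for a block of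
any finite length; blocks over increasing rationals simply concatenate. -/
theorem sortedLT_flatMap_fiberList {B : List (List Bool × ℚ)}
    (hB : B.Pairwise fun b₁ b₂ => b₁.2 < b₂.2) :
    ((B.flatMap fiberList).map Prod.snd).SortedLT := by
  simp only [List.map_flatMap, map_snd_fiberList]
  refine List.Pairwise.sortedLT (List.pairwise_flatMap.2 ⟨fun b _ => ?_, hB.imp ?_⟩)
  · refine List.pairwise_map.2 (List.pairwise_lt_range.imp fun h => ?_)
    exact Prod.Lex.toLex_lt_toLex.2 (Or.inr ⟨rfl, h⟩)
  · intro b₁ b₂ h x hx y hy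
    obtain ⟨i, -, rfl⟩ := List.mem_map.1 hx
    obtain ⟨j, -, rfl⟩ := List.mem_map.1 hy
    exact Prod.Lex.toLex_lt_toLex.2 (Or.inl h)

/-- The list consisting of `n` repetitions of `m` negative signs followed by `m` positive ones. -/
def alternating (m : ℕ) : ℕ → List Bool
  | 0 => []
  | n + 1 => alternating m n ++ (List.replicate m false ++ List.replicate m true)

/-- Each run of `alternating 1` contains both signs, so one run suffices per entry. -/
theorem sublist_alternating (η : List Bool) : η.Sublist (alternating 1 η.length) := by
  induction η using List.reverseRecOn with
  | nil => exact List.nil_sublist _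
  | append_singleton η e ih =>
    rw [List.length_append]
    refine ih.append ?_
    cases e <;> decide

theorem alternating_sublist {m m' : ℕ} (h : m ≤ m') (n : ℕ) :
    (alternating m n).Sublist (alternating m' n) := by
  induction n with
  | zero => exact List.nil_sublist _
  | succ n ih =>
    exact ih.append ((List.replicate_sublist_replicate _ |>.2 h).append
      (List.replicate_sublist_replicate _ |>.2 h))

theorem flatMap_const_replicate {α : Type*} (l : List α) (m : ℕ) (e : Bool) :
    (l.flatMap fun _ => List.replicate m e) = List.replicate (l.length * m) e := by
  induction l with
  | nil => simp
  | cons a l ih =>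
    rw [List.flatMap_cons, ih, List.replicate_append_replicate, List.length_cons]
    congr 1
    ring

end Blocks

/-! ### The dichotomy: independence or a tree -/

section Dichotomy

variable {V : FirstOrder.Language.{u, v}} {p q : ℕ}

/-- A family indexed by `ℚ ×ₗ ℕ` is a pattern family with value function `γ` if the values of its
patterns depend, by `γ`, only on the signs. -/
def IsPatternFamily (N : RStructure.{u, v, w} V) (φ : CFormula V (p + q))
    (c : ℚ ×ₗ ℕ → Fin q → N.carrier) (γ : List Bool → unitInterval) : Prop :=
  ∀ l : List (Bool × ℚ ×ₗ ℕ), (l.map Prod.snd).SortedLT →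
    patInf N φ (l.map fun e => (e.1, c e.2)) = γ (l.map Prod.fst)

variable {N : RStructure.{u, v, w} V} {φ : CFormula V (p + q)} {c : ℚ ×ₗ ℕ → Fin q → N.carrier}
  {γ : List Bool → unitInterval}

theorem IsPatternFamily.flatMap (hγ : IsPatternFamily N φ c γ) {B : List (List Bool × ℚ)}
    (hB : B.Pairwise fun b₁ b₂ => b₁.2 < b₂.2) :
    patInf N φ ((B.flatMap fiberList).map fun e => (e.1, c e.2)) = γ (B.flatMap Prod.fst) := by
  rw [hγ _ (sortedLT_flatMap_fiberList hB), map_fst_flatMap_fiberList]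

/-- Realise `η₂` over one fibre; a sublist of that realisation realises `η₁` and imposes fewer
conditions. -/
theorem IsPatternFamily.mono (hγ : IsPatternFamily N φ c γ) {η₁ η₂ : List Bool}
    (h : η₁.Sublist η₂) : γ η₁ ≤ γ η₂ := by
  have hs : ((fiberList (η₂, 0)).map Prod.snd).SortedLT := by
    simpa using sortedLT_flatMap_fiberList (B := [(η₂, 0)]) (List.pairwise_singleton _ _)
  have hf : (fiberList (η₂, 0)).map Prod.fst = η₂ := map_fst_fiberList _
  rw [← hf] at h
  obtain ⟨l, hl, rfl⟩ := List.sublist_map_iff.1 h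
  conv_rhs => rw [← hf]
  rw [← hγ _ hs, ← hγ l ((hs.pairwise.sublist (hl.map _)).sortedLT)]
  exact patInf_mono (hl.map _).subset

/-- Every sign pattern is a sublist of some `alternating 1 n` and so has value `0`. Hence each `Z`
is approximated within `s`, and the threshold makes the values exact. -/
theorem IsPatternFamily.exists_independence (hγ : IsPatternFamily N φ c γ)
    (h : ∀ m n, γ (alternating m n) = 0) {s r : unitInterval} (hsr : s < r) (hs : 0 < s)
    (hr : r ≤ unitInterval.symm s) (m : ℕ) :
    ∃ (a : Set (Fin m) → Fin p → N.carrier) (b : Fin m → Fin q → N.carrier),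
      ∀ (n : Fin m) (Z : Set (Fin m)),
        (n ∈ Z → (φ.comp (threshold s r)).eval₂ N (a Z) (b n) = 0) ∧
        (n ∉ Z → (φ.comp (threshold s r)).eval₂ N (a Z) (b n) = 1) := by
  classical
  have key : ∀ Z : Set (Fin m), ∃ x : Fin p → N.carrier, ∀ n : Fin m,
      lit (decide (n ∈ Z)) (φ.eval₂ N x (c (toLex (0, (n : ℕ))))) ≤ s := by
    intro Z
    let l : List (Bool × ℚ ×ₗ ℕ) :=
      (List.finRange m).map fun n => (decide (n ∈ Z), toLex ((0 : ℚ), (n : ℕ)))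
    have hl : (l.map Prod.snd).SortedLT := by
      rw [List.map_map]
      refine List.Pairwise.sortedLT (List.pairwise_map.2 ?_)
      refine (List.sortedLT_finRange m).pairwise.imp fun h => ?_
      exact Prod.Lex.toLex_lt_toLex.2 (Or.inr ⟨rfl, h⟩)
    have h0 : patInf N φ (l.map fun e => (e.1, c e.2)) < s := by
      rw [hγ l hl]
      exact ((hγ.mono (sublist_alternating _)).trans (h _ _).le).trans_lt hs
    obtain ⟨x, hx⟩ := iInf_lt_iff.1 h0
    refine ⟨x, fun n => patVal_le_iff.1 hx.le (decide (n ∈ Z), c (toLex ((0 : ℚ), (n : ℕ)))) ?_⟩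
    exact List.mem_map.2 ⟨(decide (n ∈ Z), toLex ((0 : ℚ), (n : ℕ))),
      List.mem_map.2 ⟨n, List.mem_finRange n, rfl⟩, rfl⟩
  choose a ha using key
  refine ⟨a, fun n => c (toLex (0, (n : ℕ))), fun n Z => ⟨fun hn => ?_, fun hn => ?_⟩⟩
  · have := ha Z n
    simp only [hn, decide_true, lit] at this
    exact threshold_eq_zero hsr this
  · have := ha Z n
    simp only [hn, decide_false, lit] at this
    exact threshold_eq_one hsr (hr.trans (unitInterval.symm_le_comm.1 this))

theorem IsPatternFamily.exists_tree (hγ : IsPatternFamily N φ c γ) {n m : ℕ}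
    (h₀ : ∀ m, γ (alternating m (n + 1)) = 0) (h₁ : γ (alternating m (n + 2)) ≠ 0) :
    ∃ (q' : ℕ) (θ : CFormula V (p + q')) (b : List Bool → Fin q' → N.carrier),
      (∀ (σ : ℕ → Bool) (n : ℕ),
        (⨅ x : Fin p → N.carrier, ⨆ k : Fin n, θ.eval₂ N x (b (initSeg σ k))) = 0) ∧
      (∀ μ ν : List Bool, ¬ μ <+: ν → ¬ ν <+: μ →
        (⨅ x : Fin p → N.carrier, max (θ.eval₂ N x (b μ)) (θ.eval₂ N x (b ν))) = 1) := by
  set r := γ (alternating m (n + 2)) with hr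
  -- With `0 < s < r`, the threshold sends patterns realised within `s` to `0` and those of value at
  -- least `r` to `1`.
  obtain ⟨s, hs, hsr⟩ := exists_between (unitInterval.pos_iff_ne_zero.2 h₁)
  obtain ⟨q', θ, hθ⟩ := exists_formula_patVal φ (alternating m (n + 1)) (threshold s r)
  let neg : List Bool → List Bool × ℚ := fun μ => (List.replicate m false, lowerEnd μ)
  let pos : List Bool → List Bool × ℚ := fun μ => (List.replicate m true, upperEnd μ)
  -- All intervals lie in `[0, 1]`, so `-1` puts the base to the left of every node.
  let base : List Bool × ℚ := (alternating m n, -1)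
  let C : List (List Bool × ℚ) → List (Bool × (Fin q → N.carrier)) := fun B =>
    (B.flatMap fiberList).map fun e => (e.1, c e.2)
  have hC : ∀ {B₁ B₂ : List (List Bool × ℚ)}, B₁ ⊆ B₂ → C B₁ ⊆ C B₂ := fun h =>
    by
    refine List.map_subset _ fun e he => ?_
    obtain ⟨B, hB, he⟩ := List.mem_flatMap.1 he
    exact List.mem_flatMap.2 ⟨B, h hB, he⟩
  have hnode : ∀ μ, (C [base, neg μ, pos μ]).map Prod.fst = alternating m (n + 1) := by
    intro μ
    change (List.map _ (List.map _ _)) = _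
    rw [List.map_map]
    refine (map_fst_flatMap_fiberList _).trans ?_
    simp [base, neg, pos, alternating]
  choose b hb using fun μ => hθ N _ (hnode μ)
  refine ⟨q', θ, b, fun σ k => ?_, fun μ ν hμν hνμ => ?_⟩
  -- Left ends increase along the branch and right ends decrease, hence the reversal; every left end
  -- precedes every right end.
  · let B : List (List Bool × ℚ) := base :: ((List.range k).map (fun i => neg (initSeg σ i)) ++
      (List.range k).reverse.map fun i => pos (initSeg σ i))
    have hB : B.Pairwise fun b₁ b₂ => b₁.2 < b₂.2 := by
      refine List.pairwise_cons.2 ⟨fun b' hb' => ?_, List.pairwise_append.2 ⟨?_, ?_, ?_⟩⟩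
      · have hneg : (-1 : ℚ) < 0 := by norm_num
        rcases List.mem_append.1 hb' with hb' | hb' <;> obtain ⟨i, -, rfl⟩ := List.mem_map.1 hb'
        · exact hneg.trans_le (lowerEnd_upperEnd_bounds _).1
        · exact hneg.trans ((lowerEnd_upperEnd_bounds _).1.trans_lt
            (lowerEnd_upperEnd_bounds _).2.1)
      · exact List.pairwise_map.2 (List.pairwise_lt_range.imp
          fun h => strictMono_lowerEnd_initSeg σ h)
      · exact List.pairwise_map.2 (List.pairwise_reverse.2 (List.pairwise_lt_range.imp
          fun h => strictAnti_upperEnd_initSeg σ h))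
      · intro b₁ hb₁ b₂ hb₂
        obtain ⟨i, -, rfl⟩ := List.mem_map.1 hb₁
        obtain ⟨j, -, rfl⟩ := List.mem_map.1 hb₂
        exact ((strictMono_lowerEnd_initSeg σ).monotone (le_max_left i j)).trans_lt
          ((lowerEnd_upperEnd_bounds (initSeg σ (max i j))).2.1.trans_le
            ((strictAnti_upperEnd_initSeg σ).antitone (le_max_right i j)))
    -- The run length `m + k * m` accommodates both the base runs of length `m` and the merged run
    -- of length `k * m`.
    have hlabels : (B.flatMap Prod.fst).Sublist (alternating (m + k * m) (n + 1)) := by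
      have : B.flatMap Prod.fst = alternating m n ++
          (List.replicate (k * m) false ++ List.replicate (k * m) true) := by
        simp [B, base, neg, pos, List.flatMap_map, flatMap_const_replicate, -List.map_reverse]
      rw [this]
      exact (alternating_sublist (by omega) n).append
        (((List.replicate_sublist_replicate _).2 (by omega)).append
          ((List.replicate_sublist_replicate _).2 (by omega)))
    have hlt : patInf N φ (C B) < s := by
      rw [hγ.flatMap hB]
      exact ((hγ.mono hlabels).trans (h₀ _).le).trans_lt hs
    obtain ⟨x, hx⟩ := iInf_lt_iff.1 hlt
    refine le_antisymm ((iInf_le _ x).trans (iSup_le fun i => le_of_eq ?_)) bot_le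
    rw [hb]
    refine threshold_eq_zero hsr ((patVal_mono (hC ?_)).trans hx.le)
    have hi : (i : ℕ) ∈ List.range k := List.mem_range.2 i.2
    simp only [B, List.cons_subset, List.nil_subset, and_true]
    refine ⟨List.mem_cons_self, List.mem_cons_of_mem _ (List.mem_append_left _ ?_),
      List.mem_cons_of_mem _ (List.mem_append_right _ ?_)⟩
    · exact List.mem_map.2 ⟨i, hi, rfl⟩
    · exact List.mem_map.2 ⟨i, List.mem_reverse.2 hi, rfl⟩
  · refine le_antisymm unitInterval.le_one' (le_iInf fun x => ?_)
    suffices H : ∀ μ ν, upperEnd μ < lowerEnd ν →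
        r ≤ max (patVal N φ x (C [base, neg μ, pos μ])) (patVal N φ x (C [base, neg ν, pos ν])) by
      have hr' : r ≤ max (patVal N φ x (C [base, neg μ, pos μ]))
          (patVal N φ x (C [base, neg ν, pos ν])) := by
        rcases upperEnd_lt_lowerEnd_or hμν hνμ with h | h
        · exact H μ ν h
        · rw [max_comm]; exact H ν μ h
      rcases le_max_iff.1 hr' with h | h
      · exact le_max_of_le_left (by rw [hb, threshold_eq_one hsr h])
      · exact le_max_of_le_right (by rw [hb, threshold_eq_one hsr h])
    intro μ ν h
    have hμ := lowerEnd_upperEnd_bounds μ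
    have hν := lowerEnd_upperEnd_bounds ν
    have hB : [base, neg μ, pos μ, neg ν, pos ν].Pairwise fun b₁ b₂ => b₁.2 < b₂.2 := by
      simp only [base, neg, pos, List.pairwise_cons, List.mem_cons, List.not_mem_nil, or_false,
        forall_eq_or_imp, forall_eq, IsEmpty.forall_iff, implies_true, List.Pairwise.nil, and_true]
      refine ⟨⟨?_, ?_, ?_, ?_⟩, ⟨?_, ?_, ?_⟩, ⟨?_, ?_⟩, ?_⟩ <;> linarith
    -- The second base is the same as the first, so the two nodes together assert exactly `n + 2`
    -- runs.
    have e : r = patInf N φ (C [base, neg μ, pos μ, neg ν, pos ν]) := by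
      rw [hγ.flatMap hB, hr]
      simp [base, neg, pos, alternating]
    rw [e]
    refine (iInf_le _ x).trans (patVal_le_iff.2 fun e he => ?_)
    have : e ∈ C [base, neg μ, pos μ] ∨ e ∈ C [base, neg ν, pos ν] := by
      simp only [C, List.flatMap_cons, List.flatMap_nil, List.map_append, List.mem_append] at he ⊢
      tauto
    rcases this with h | h
    · exact le_max_of_le_left (patVal_le_iff.1 le_rfl e h)
    · exact le_max_of_le_right (patVal_le_iff.1 le_rfl e h)

end Dichotomy

/-! ### The two directions of the equivalence -/

section MainTheorem

variable {V : FirstOrder.Language.{u, v}} {T : Set (CSentence V)}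

theorem hasSOP₂_or_hasIP_of_isUnstable (hT : IsUnstable.{u, v, w} T) :
    HasSOP₂.{u, v, w} T ∨ HasIP.{u, v, w} T := by
  simp only [IsUnstable, IsStable, UnstableFormula, not_forall, not_not] at hT
  obtain ⟨p, q, φ, s, r, hsr, M, hM, a, b, hab⟩ := hT
  obtain ⟨N, hN, c, γ, hγ, hγ₀⟩ := exists_indiscernible hM (φ.comp (threshold s r))
    -- Even indices for `a` and odd ones for `b` settle the diagonal case `h = k`, about which the
    -- hypothesis says nothing.
    (fun h => a (2 * h)) (fun k => b (2 * k + 1))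
    (fun h k hk => threshold_eq_zero hsr (hab _ _ (by omega)).1)
    (fun h k hk => threshold_eq_one hsr (hab _ _ (by omega)).2) (ℚ ×ₗ ℕ)
  replace hγ : IsPatternFamily N (φ.comp (threshold s r)) c γ := hγ
  by_cases hgood : ∀ n m, γ (alternating m n) = 0
  · refine Or.inr ⟨p, q, _, N, hN, hγ.exists_independence (fun m n => hgood n m)
      (s := ⟨1 / 3, by norm_num, by norm_num⟩) (r := ⟨2 / 3, by norm_num, by norm_num⟩) ?_ ?_ ?_⟩
    · exact Subtype.coe_lt_coe.1 (by norm_num)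
    · exact Subtype.coe_lt_coe.1 (by norm_num)
    · exact Subtype.coe_le_coe.1 (by norm_num)
  · classical
    replace hgood := not_forall.1 hgood
    -- No run or a single run has value `0` by the order pattern, so the least failure is at least
    -- `2`.
    obtain ⟨n, hn⟩ : ∃ n, Nat.find hgood = n + 2 := by
      have h0 : Nat.find hgood ≠ 0 := fun h0 => by
        have := Nat.find_spec hgood
        rw [h0] at this
        exact this fun m => hγ₀ 0 0
      have h1 : Nat.find hgood ≠ 1 := fun h1 => by
        have := Nat.find_spec hgood
        rw [h1] at this
        exact this fun m => hγ₀ m m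
      exact ⟨Nat.find hgood - 2, by omega⟩
    have h₀ : ∀ m, γ (alternating m (n + 1)) = 0 :=
      not_not.1 (Nat.find_min hgood (by omega))
    obtain ⟨m, h₁⟩ := not_forall.1 (hn ▸ Nat.find_spec hgood)
    obtain ⟨q', θ, b', hb'⟩ := hγ.exists_tree h₀ h₁
    exact Or.inl ⟨p, q', θ, N, hN, b', hb'⟩

/-- With `Z = {n | h < n}` the value at `n` is `0` exactly when `h < n`, which is an order pattern
of length `m`. The ultrapower over `m` makes it infinite; the default values of `b'`, used for `m ≤
k`, are negligible. -/
theorem isUnstable_of_hasIP (hT : HasIP.{u, v, w} T) : IsUnstable.{u, v, w} T := by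
  obtain ⟨p, q, φ, M, hM, H⟩ := hT
  choose a b hab using H
  have := M.nonempty
  let b' : ℕ → ℕ → Fin q → M.carrier := fun k m =>
    if hk : k < m then b m ⟨k, hk⟩ else fun _ => Classical.arbitrary _
  refine fun hs => hs p q φ ⟨0, 1, zero_lt_one, ultrapower M (hyperfilter ℕ), hM.ultrapower _,
    fun h j m => a m {n | h < n} j, fun k j m => b' k m j, fun h k hhk => ⟨?_, ?_⟩⟩
  · refine (tendsto_nhds_unique (tendsto_eval₂_ultrapower M _ φ _ _)
      (tendsto_const_nhds.congr' ?_)).le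
    filter_upwards [Nat.hyperfilter_le_atTop (eventually_gt_atTop k)] with m hm
    simp only [b', dif_pos hm]
    exact ((hab m ⟨k, hm⟩ {n | h < n}).1 hhk).symm
  · refine (tendsto_nhds_unique (tendsto_eval₂_ultrapower M _ φ _ _)
      (tendsto_const_nhds.congr' ?_)).ge
    filter_upwards [Nat.hyperfilter_le_atTop (eventually_gt_atTop h)] with m hm
    simp only [b', dif_pos hm]
    exact ((hab m ⟨h, hm⟩ {n | k < n}).2 hhk.not_gt).symm

/-- Let `x` nearly satisfy the branch that follows the zeros for `h` steps and then turns off. It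
satisfies the nodes `0^k` with `k ≤ h` within `t`; for `k > h` the node `0^k` is incomparable with
`0^h 1`, where the value is below `1`, so its own value is `1`. -/
theorem isUnstable_of_hasSOP₂ (hT : HasSOP₂.{u, v, w} T) : IsUnstable.{u, v, w} T := by
  obtain ⟨p, q, θ, M, hM, b, hb₀, hb₁⟩ := hT
  obtain ⟨t, ht₀, ht₁⟩ := exists_between (zero_lt_one (α := unitInterval))
  have key : ∀ h : ℕ, ∃ x : Fin p → M.carrier,
      (∀ k ≤ h, θ.eval₂ M x (b (List.replicate k false)) ≤ t) ∧
      ∀ k > h, θ.eval₂ M x (b (List.replicate k false)) = 1 := by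
    intro h
    let σ : ℕ → Bool := fun i => decide (i = h)
    -- Depth `h + 2` is needed to include the node `0^h 1`, of length `h + 1`.
    obtain ⟨x, hx⟩ := iInf_lt_iff.1 ((hb₀ σ (h + 2)).trans_lt ht₀)
    have hx' : ∀ k < h + 2, θ.eval₂ M x (b (initSeg σ k)) < t := fun k hk =>
      (le_iSup (fun i : Fin (h + 2) => θ.eval₂ M x (b (initSeg σ i))) ⟨k, hk⟩).trans_lt hx
    refine ⟨x, fun k hk => ?_, fun k hk => ?_⟩
    · have e : initSeg σ k = List.replicate k false := by
        refine List.eq_replicate_iff.2 ⟨by simp [initSeg], fun e he => ?_⟩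
        obtain ⟨i, rfl⟩ := List.mem_ofFn.1 he
        have := i.2
        exact decide_eq_false (by omega)
      exact e ▸ (hx' k (by omega)).le
    · have hlen : (initSeg σ (h + 1)).length = h + 1 := by simp [initSeg]
      have hmem : true ∈ initSeg σ (h + 1) :=
        List.mem_ofFn.2 ⟨Fin.last h, decide_eq_true rfl⟩
      have hpre : ¬ initSeg σ (h + 1) <+: List.replicate k false := fun hp =>
        absurd (List.eq_of_mem_replicate (hp.subset hmem)) (by decide)
      have hpre' : ¬ List.replicate k false <+: initSeg σ (h + 1) := fun hp => by
        have hle := hp.length_le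
        rw [hlen, List.length_replicate] at hle
        exact hpre (hp.eq_of_length (by simp [hlen]; omega) ▸ List.prefix_rfl)
      have hmax := (hb₁ _ _ hpre hpre').ge.trans (iInf_le _ x)
      refine le_antisymm unitInterval.le_one' ((le_max_iff.1 hmax).resolve_left fun hle => ?_)
      exact absurd ((hle.trans_lt (hx' (h + 1) (by omega))).trans ht₁) (lt_irrefl _)
  choose a ha using key
  -- Negating `θ` gives values `0` for `h < k` and at least `1 - t` in the opposite order.
  refine fun hs => hs p q (θ.comp ⟨unitInterval.symm, unitInterval.continuous_symm⟩)
    ⟨0, unitInterval.symm t, unitInterval.lt_symm_comm.1 (by simpa using ht₁), M, hM, a,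
      fun k => b (List.replicate k false), fun h k hhk => ⟨?_, ?_⟩⟩
  · rw [CFormula.eval₂_comp, (ha h).2 k hhk]
    exact unitInterval.symm_one.le
  · rw [CFormula.eval₂_comp]
    exact unitInterval.symm_le_symm.2 ((ha k).1 h hhk.le)

end MainTheorem

end ContinuousLogic

theorem mainTheorem9 (V : FirstOrder.Language.{u, v}) [Countable V.Symbols]
    (T : Set (ContinuousLogic.CSentence V)) (hT : ContinuousLogic.IsMetricTheory.{u, v, w} T) :
    ContinuousLogic.IsUnstable.{u, v, w} T ↔
      ContinuousLogic.HasSOP₂.{u, v, w} T ∨ ContinuousLogic.HasIP.{u, v, w} T :=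
  ⟨ContinuousLogic.hasSOP₂_or_hasIP_of_isUnstable, fun h =>
    h.elim ContinuousLogic.isUnstable_of_hasSOP₂ ContinuousLogic.isUnstable_of_hasIP⟩
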